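/- Let $G=(V,E)$ be a finite graph (loops and parallel edges allowed) with real edge weights, cellularly embedded on a compact orientable surface $\Sigma$, possibly with boundary, so that each boundary component is traced by a facial walk of $G$. The embedding is given combinatorially by a rotation system (a cyclic order of the edge ends around each vertex) together with an orientation signature $\mathrm{sig}:E\to\mathbb{Z}_2$; orientability of $\Sigma$ means that every cycle of $G$ (every edge set meeting each vertex an even number of times, loops counted twice) has total signature $0$. A shortest $x,y$-path is a path from $x$ to $y$ without repeated vertices whose total weight is minimum among all such paths; assume that shortest paths are unique, i.e. for all $x,y\in V$ there is at most one shortest $x,y$-path. A simple cycle $\gamma$ (the edge set of a closed path of positive length with no repeated edge and no repeated vertex except that the first and last coincide) is isometric if for all vertices $x,y$ of $\gamma$ it contains a shortest $x,y$-path. Two cycles $\gamma,\gamma'$ are in the same $\mathbb{Z}_2$-homology class if $\gamma\oplus\gamma'$ is the boundary of a set $F'$ of faces (boundary components not included), i.e. if $\gamma\oplus\gamma'$ consists of exactly those edges for which exactly one of the two sides lies on a face of $F'$. Simple cycles $\gamma,\gamma'$ cross if there is a maximal (possibly trivial, i.e. one-vertex) common subpath $p$ of $\gamma$ and $\gamma'$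 such that, after contracting $p$ to a vertex, the two ends of edges of $\gamma$ and the two ends of edges of $\gamma'$ by which the cycles leave $p$ alternate in the cyclic order around that vertex. Then any two isometric cycles $\gamma,\gamma'$ of $G$ that are in the same $\mathbb{Z}_2$-homology class do not cross. -/

import Mathlib

/-- A graph with vertex set `V` and edge set `E` (loops and parallel edges allowed), together with
a cellular embedding in a surface, given by a rotation system and an orientation signature.

A dart `(e, b) : E × Bool` is the edge `e` with one of its two directions, equivalently one of the
two ends of `e`; `tail d` is the vertex at which `d` starts. -/
structure EmbeddedGraph (V E : Type*) where
  /-- the initial vertex of a dart -/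
  tail : E × Bool → V
  /-- the rotation system: the next dart in the cyclic order around the common tail -/
  rot : Equiv.Perm (E × Bool)
  tail_rot : ∀ d, tail (rot d) = tail d
  rot_sameCycle : ∀ d d', tail d = tail d' → rot.SameCycle d d'
  /-- the orientation signature: `0` if the cyclic orders at the two ends of the edge have the same
  direction along the edge, `1` otherwise -/
  sig : E → ZMod 2

namespace EmbeddedGraph

variable {V E : Type*}

/-- The reversal of a dart. -/
def rev (d : E × Bool) : E × Bool := (d.1, !d.2)

/-- The final vertex of a dart. -/
def head (G : EmbeddedGraph V E) (d : E × Bool) : V := G.tail (rev d)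

/-! ### Walks, paths, shortest paths -/

/-- `G.IsWalk u p v`: the list of darts `p` is a walk from `u` to `v`. -/
def IsWalk (G : EmbeddedGraph V E) : V → List (E × Bool) → V → Prop
  | u, [], v => u = v
  | u, d :: p, v => G.tail d = u ∧ G.IsWalk (G.head d) p v

/-- `G.IsPath u p v`: `p` is a walk from `u` to `v` that repeats no vertex. -/
def IsPath (G : EmbeddedGraph V E) (u : V) (p : List (E × Bool)) (v : V) : Prop :=
  G.IsWalk u p v ∧ (u :: p.map G.head).Nodup

/-- The total weight of a walk. -/
def weight (w : E → ℝ) (p : List (E × Bool)) : ℝ := (p.map fun d => w d.1).sum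

/-- `p` is a path from `u` to `v` of minimum weight. -/
def IsShortestPath (G : EmbeddedGraph V E) (w : E → ℝ) (u : V) (p : List (E × Bool)) (v : V) :
    Prop :=
  G.IsPath u p v ∧ ∀ q, G.IsPath u q v → weight w p ≤ weight w q

/-- Between any two vertices there is at most one shortest path. -/
def UniqueShortestPaths (G : EmbeddedGraph V E) (w : E → ℝ) : Prop :=
  ∀ u v p q, G.IsShortestPath w u p v → G.IsShortestPath w u q v → p = q

/-! ### Cycles -/

/-- An element of the cycle space: every vertex is incident to an even number of edges of `η`
(a loop counts twice). -/
def IsCycle [DecidableEq V] [Fintype E] [DecidableEq E] (G : EmbeddedGraph V E)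
    (η : Finset E) : Prop :=
  ∀ v, Even (Finset.univ.filter fun d : E × Bool => d.1 ∈ η ∧ G.tail d = v).card

/-- `γ` is the edge set of a simple closed path. -/
def IsSimpleCycle [DecidableEq E] (G : EmbeddedGraph V E) (γ : Finset E) : Prop :=
  ∃ u p, p ≠ [] ∧ G.IsWalk u p u ∧ (p.map G.head).Nodup ∧ (p.map Prod.fst).Nodup ∧
    γ = (p.map Prod.fst).toFinset

/-- The vertex `x` lies on `γ`. -/
def OnCycle (G : EmbeddedGraph V E) (γ : Finset E) (x : V) : Prop :=
  ∃ d : E × Bool, d.1 ∈ γ ∧ G.tail d = x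

/-- A simple cycle is isometric if it contains, for any two of its vertices, a shortest path
between them. -/
def IsIsometricCycle [DecidableEq E] (G : EmbeddedGraph V E) (w : E → ℝ) (γ : Finset E) : Prop :=
  G.IsSimpleCycle γ ∧
    ∀ x y, G.OnCycle γ x → G.OnCycle γ y → ∃ p, G.IsShortestPath w x p y ∧ ∀ d ∈ p, d.1 ∈ γ

/-- The surface is orientable: every cycle of the graph is two-sided. -/
def Orientable [DecidableEq V] [Fintype E] [DecidableEq E] (G : EmbeddedGraph V E) : Prop :=
  ∀ η : Finset E, G.IsCycle η → ∑ e ∈ η, G.sig e = 0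

/-! ### Flags, faces and homology -/

/-- A flag `(d, s)` is a dart `d` with one of the two local orientations at its tail: the one given
by the rotation system (`s = 0`) or the opposite one (`s = 1`). Reading the rotation as
counterclockwise, it also names a side of `d`: the right side of `d` with respect to `s`. -/
abbrev Flag (E : Type*) : Type _ := (E × Bool) × ZMod 2

/-- Turn to the next dart around the same vertex, in the direction given by the local
orientation. -/
def turn (G : EmbeddedGraph V E) (f : Flag E) : Flag E :=
  (if f.2 = 0 then G.rot f.1 else G.rot.symm f.1, f.2)

/-- Go along the edge to its other end, carrying the local orientation along. -/
def hop (G : EmbeddedGraph V E) (f : Flag E) : Flag E := (rev f.1, f.2 + G.sig f.1.1)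

/-- Two flags belong to the same face if they are connected by steps of the following kinds:
go along the edge and turn (walking along the face), or reverse the direction of the walk
while staying on the same side of the same edge. -/
def FaceStep (G : EmbeddedGraph V E) (f f' : Flag E) : Prop :=
  f' = G.turn (G.hop f) ∨ f' = ((G.hop f).1, (G.hop f).2 + 1)

/-- The facial walks of the embedding. -/
def Face (G : EmbeddedGraph V E) : Type _ := Quot G.FaceStep

/-- The face on a given side of a dart. -/
def face (G : EmbeddedGraph V E) (f : Flag E) : G.Face := Quot.mk _ f

/-- The edge `e` is on the boundary of the set `F` of faces: exactly one of the faces on its two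
sides is in `F`. -/
def InBoundary (G : EmbeddedGraph V E) (F : Set G.Face) (e : E) : Prop :=
  Xor (G.face ((e, false), 0) ∈ F) (G.face ((e, false), 1) ∈ F)

/-- `B` is the set of those facial walks that bound a boundary component of the surface instead of
a face. The edge set `η` is null-homologous (over the field with two elements) if it is the
boundary of a set of faces. -/
def NullHomologous (G : EmbeddedGraph V E) (B : Set G.Face) (η : Finset E) : Prop :=
  ∃ F : Set G.Face, Disjoint F B ∧ ∀ e, e ∈ η ↔ G.InBoundary F e

/-- `η` and `η'` are in the same homology class. -/
def Homologous [DecidableEq E] (G : EmbeddedGraph V E) (B : Set G.Face) (η η' : Finset E) : Prop :=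
  G.NullHomologous B (symmDiff η η')

/-! ### Crossing -/

/-- The rotation around the vertex that results from contracting the edges of a path `p`: turn to
the next dart, where the darts of `p` that are met are followed to their other end and the rotation
is continued there. (The rotation of the contracted vertex is the cyclic order in which this map
visits the darts that are not on `p`.) -/
def contractedTurn [DecidableEq E] (G : EmbeddedGraph V E) (p : List (E × Bool)) (f : Flag E) :
    Flag E :=
  if f.1.1 ∈ p.map Prod.fst then G.turn (G.hop f) else G.turn f

/-- `x, y, z, t` are met in this order when `ρ` is iterated from `x`, before the return to `x`. -/
def InCyclicOrder {α : Type*} (ρ : α → α) (x y z t : α) : Prop :=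
  ∃ i j k : ℕ, 0 < i ∧ i < j ∧ j < k ∧ ρ^[i] x = y ∧ ρ^[j] x = z ∧ ρ^[k] x = t ∧
    ∀ m, 0 < m → m ≤ k → ρ^[m] x ≠ x

/-- The simple cycles `γ` and `γ'` cross: they have a common (possibly trivial) subpath `p`, from
`u` to `v`, which `γ` continues by the edge ends `a₁` (at `u`) and `a₂` (at `v`), and `γ'` by `b₁`
and `b₂`; `p` is maximal, i.e. none of these four edges is common to `γ` and `γ'`; and when `p` is
contracted to a vertex, the ends `a₁, a₂` and `b₁, b₂` alternate around it. (The reversed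
cyclic order `a₁, b₂, a₂, b₁` is obtained from the opposite local orientations.) -/
def Cross [DecidableEq E] (G : EmbeddedGraph V E) (γ γ' : Finset E) : Prop :=
  ∃ (u v : V) (p : List (E × Bool)) (a₁ a₂ b₁ b₂ : E × Bool) (s₁ s₂ t₁ t₂ : ZMod 2),
    G.IsPath u p v ∧ (∀ d ∈ p, d.1 ∈ γ ∧ d.1 ∈ γ') ∧
    a₁ ≠ a₂ ∧ b₁ ≠ b₂ ∧
    G.tail a₁ = u ∧ G.tail b₁ = u ∧ G.tail a₂ = v ∧ G.tail b₂ = v ∧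
    a₁.1 ∈ γ \ γ' ∧ a₂.1 ∈ γ \ γ' ∧ b₁.1 ∈ γ' \ γ ∧ b₂.1 ∈ γ' \ γ ∧
    InCyclicOrder (G.contractedTurn p) (a₁, s₁) (b₁, t₁) (a₂, s₂) (b₂, t₂)

end EmbeddedGraph

/-! A set of faces bounding η = γ ⊕ γ' gives a function χ on flags with values in ℤ₂: whether the
named side lies in the set. Turning away from a dart, or hopping along it, changes χ exactly when
its edge is in η (`NullHomologous.exists_isSideIndicator`).

Suppose γ and γ' cross at a maximal common path p from u to v. By uniqueness, the shortest paths
from u to any common vertex inside γ and inside γ' coincide, so they consist of common edges and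
cannot leave p: all common vertices lie on p (`IsIsometricCycle.mem_of_onCycle`). Hence γ outside p
is an excursion r from u to v whose interior avoids γ'.

The value of χ at a₂ is now computed in two ways. Along r, each interior vertex flips χ once and
each edge once, an odd number in all (`IsSideIndicator.exists_excursion`). Around the contracted p,
the turn from a₁ to a₂ passes the η-darts a₁ and b₁ only, so χ flips twice
(`IsSideIndicator.eq_of_inCyclicOrder`). The local orientations reached at a₂ differ from the
initial one by the signatures of r and of p, which agree by orientability (`Orientable.sum_sig_eq`);
this is the contradiction. -/

namespace EmbeddedGraph

/-! ### Walks, paths and local orientations along a path -/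

section Walks

variable {V E : Type*} (G : EmbeddedGraph V E)

@[simp] theorem rev_rev (d : E × Bool) : rev (rev d) = d := by simp [rev]

@[simp] theorem rev_fst (d : E × Bool) : (rev d).1 = d.1 := rfl

theorem rev_ne (d : E × Bool) : rev d ≠ d := by
  intro h
  have := congrArg Prod.snd h
  simp [rev] at this

theorem eq_or_eq_rev {d e : E × Bool} (h : d.1 = e.1) : d = e ∨ d = rev e := by
  obtain ⟨d, b⟩ := d
  obtain ⟨e, c⟩ := e
  cases b <;> cases c <;> simp_all [rev]

@[simp] theorem tail_rev (d : E × Bool) : G.tail (rev d) = G.head d := rfl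

@[simp] theorem head_rev (d : E × Bool) : G.head (rev d) = G.tail d := by simp [head]

theorem tail_rot_symm (d : E × Bool) : G.tail (G.rot.symm d) = G.tail d := by
  rw [← G.tail_rot (G.rot.symm d), Equiv.apply_symm_apply]

@[simp] theorem tail_turn (f : Flag E) : G.tail (G.turn f).1 = G.tail f.1 := by
  unfold turn
  split_ifs <;> simp [tail_rot, tail_rot_symm]

theorem mem_or_rev_mem {p : List (E × Bool)} {d : E × Bool} (h : d.1 ∈ p.map Prod.fst) :
    d ∈ p ∨ rev d ∈ p := by
  obtain ⟨e, he, hd⟩ := List.mem_map.1 h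
  rcases eq_or_eq_rev hd with rfl | rfl
  · exact .inl he
  · exact .inr he

theorem IsWalk.append {u v x : V} {p q : List (E × Bool)} (hp : G.IsWalk u p v)
    (hq : G.IsWalk v q x) : G.IsWalk u (p ++ q) x := by
  induction p generalizing u with
  | nil => cases hp; exact hq
  | cons d p ih => exact ⟨hp.1, ih hp.2⟩

theorem IsWalk.exists_of_append {u v : V} {p q : List (E × Bool)} (h : G.IsWalk u (p ++ q) v) :
    ∃ x, G.IsWalk u p x ∧ G.IsWalk x q v := by
  induction p generalizing u with
  | nil => exact ⟨u, rfl, h⟩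
  | cons d p ih =>
    obtain ⟨x, h₁, h₂⟩ := ih h.2
    exact ⟨x, ⟨h.1, h₁⟩, h₂⟩

theorem IsWalk.reverse {u v : V} {p : List (E × Bool)} (hp : G.IsWalk u p v) :
    G.IsWalk v (p.map rev).reverse u := by
  induction p generalizing u with
  | nil => exact Eq.symm hp
  | cons d p ih =>
    rw [List.map_cons, List.reverse_cons]
    exact (ih hp.2).append G ⟨rfl, by simp [IsWalk, hp.1]⟩

theorem IsWalk.tail_mem {u v : V} {p : List (E × Bool)} (hp : G.IsWalk u p v) {d : E × Bool}
    (hd : d.1 ∈ p.map Prod.fst) : G.tail d ∈ u :: p.map G.head := by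
  induction p generalizing u with
  | nil => simp at hd
  | cons e p ih =>
    rcases List.mem_cons.1 hd with h | h
    · rcases eq_or_eq_rev h with rfl | rfl
      · simp [hp.1]
      · simp
    · exact List.mem_cons_of_mem _ (ih hp.2 h)

theorem IsWalk.end_mem {u v : V} {p : List (E × Bool)} (hp : G.IsWalk u p v) :
    v ∈ u :: p.map G.head := by
  induction p generalizing u with
  | nil => cases hp; simp
  | cons e p ih => exact List.mem_cons_of_mem _ (ih hp.2)

theorem IsWalk.map_tail_append {u v : V} {p : List (E × Bool)} (hp : G.IsWalk u p v) :
    p.map G.tail ++ [v] = u :: p.map G.head := by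
  induction p generalizing u with
  | nil => cases hp; rfl
  | cons e p ih =>
    rw [List.map_cons, List.cons_append, ih hp.2, hp.1, List.map_cons]

theorem IsPath.of_cons {u v : V} {e : E × Bool} {p : List (E × Bool)}
    (hp : G.IsPath u (e :: p) v) : G.IsPath (G.head e) p v :=
  ⟨hp.1.2, (List.nodup_cons.1 hp.2).2⟩

theorem IsPath.fst_notMem {u v : V} {e : E × Bool} {p : List (E × Bool)}
    (hp : G.IsPath u (e :: p) v) : e.1 ∉ p.map Prod.fst := fun h =>
  (List.nodup_cons.1 hp.2).1 (hp.1.1 ▸ hp.1.2.tail_mem G h)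

theorem IsPath.nodup_fst {u v : V} {p : List (E × Bool)} (hp : G.IsPath u p v) :
    (p.map Prod.fst).Nodup := by
  induction p generalizing u with
  | nil => simp
  | cons e p ih => exact List.nodup_cons.2 ⟨hp.fst_notMem G, ih (hp.of_cons G)⟩

/-- Along a path, a local orientation at the initial vertex can be propagated to all vertices. -/
theorem IsPath.exists_orientation {u v : V} {p : List (E × Bool)} (hp : G.IsPath u p v)
    (s : ZMod 2) :
    ∃ o : V → ZMod 2, o u = s ∧ o v = s + (p.map fun d => G.sig d.1).sum ∧
      ∀ d : E × Bool, d.1 ∈ p.map Prod.fst → o (G.head d) = o (G.tail d) + G.sig d.1 := by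
  classical
  induction p generalizing u s with
  | nil =>
    cases hp.1
    exact ⟨fun _ => s, rfl, by simp, by simp⟩
  | cons e p ih =>
    obtain ⟨o, h₁, h₂, h₃⟩ := ih (hp.of_cons G) (s + G.sig e.1)
    have hu : u ∉ (G.head e :: p.map G.head) := (List.nodup_cons.1 hp.2).1
    have hne : ∀ x ∈ (G.head e :: p.map G.head), Function.update o u s x = o x := fun x hx =>
      Function.update_of_ne (fun h : x = u => hu (h ▸ hx)) _ _
    refine ⟨Function.update o u s, by simp, ?_, ?_⟩
    · rw [hne v (hp.1.2.end_mem G), h₂, List.map_cons, List.sum_cons, add_assoc]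
    · have he : Function.update o u s (G.head e) =
          Function.update o u s (G.tail e) + G.sig e.1 := by
        rw [hne _ (by simp), h₁, hp.1.1]
        simp
      intro d hd
      rcases List.mem_cons.1 hd with h | h
      · rcases eq_or_eq_rev h with rfl | rfl
        · exact he
        · rw [head_rev, tail_rev, he, rev_fst, add_assoc, CharTwo.add_self_eq_zero, add_zero]
      · rw [hne _ (hp.1.2.tail_mem G h), hne (G.head d) (hp.1.2.tail_mem G (d := rev d) h)]
        exact h₃ d h

end Walks

/-! ### Simple cycles, parity of degrees, and signatures -/

section Cycles

variable {V E : Type*} [DecidableEq E] (G : EmbeddedGraph V E)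

/-- At most two darts of a simple cycle start at the same vertex. -/
theorem IsSimpleCycle.eq_or_eq {γ : Finset E} (hγ : G.IsSimpleCycle γ) {a b d : E × Bool}
    (ha : a.1 ∈ γ) (hb : b.1 ∈ γ) (hd : d.1 ∈ γ) (hab : a ≠ b) (hb' : G.tail b = G.tail a)
    (hd' : G.tail d = G.tail a) : d = a ∨ d = b := by
  obtain ⟨u, c, -, hw, hn, -, rfl⟩ := hγ
  -- For a closed walk the tails are a cyclic shift of the heads.
  have ht : (c.map G.tail).Nodup := by
    have h := hw.map_tail_append G
    have : (c.map G.tail).Perm (c.map G.head) := by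
      have h' : (c.map G.tail ++ [u]).Perm (u :: c.map G.tail) := by
        simp
      exact (List.perm_cons u).1 (h'.symm.trans (h ▸ List.Perm.refl _))
    exact this.nodup_iff.2 hn
  have inj₁ : ∀ {x y}, x ∈ c → y ∈ c → G.tail x = G.tail y → x = y := fun hx hy h =>
    List.inj_on_of_nodup_map ht hx hy h
  have inj₂ : ∀ {x y}, rev x ∈ c → rev y ∈ c → G.tail x = G.tail y → x = y := fun hx hy h => by
    have := List.inj_on_of_nodup_map hn hx hy (by simpa using h)
    simpa using congrArg rev this
  rw [List.mem_toFinset] at ha hb hd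
  -- The traversal leaves each vertex once and enters it once, so of a and b one is traversed
  -- forwards and the other backwards; d agrees with the one of its own kind.
  rcases mem_or_rev_mem ha with ha | ha <;> rcases mem_or_rev_mem hb with hb | hb
  · exact absurd (inj₁ ha hb hb'.symm) hab
  · rcases mem_or_rev_mem hd with hd | hd
    · exact .inl (inj₁ hd ha hd')
    · exact .inr (inj₂ hd hb (hd'.trans hb'.symm))
  · rcases mem_or_rev_mem hd with hd | hd
    · exact .inr (inj₁ hd hb (hd'.trans hb'.symm))
    · exact .inl (inj₂ hd ha hd')
  · exact absurd (inj₂ ha hb hb'.symm) hab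

/-- A simple cycle can be traversed starting with any of its darts. -/
theorem IsSimpleCycle.exists_walk {γ : Finset E} (hγ : G.IsSimpleCycle γ) {a : E × Bool}
    (ha : a.1 ∈ γ) :
    ∃ q, G.IsWalk (G.head a) q (G.tail a) ∧ ((a :: q).map Prod.fst).Nodup ∧
      ∀ d ∈ q, d.1 ∈ γ := by
  obtain ⟨u, c, -, hw, -, hn, rfl⟩ := hγ
  have key : ∀ d ∈ c, ∃ q, G.IsWalk (G.head d) q (G.tail d) ∧ ((d :: q).map Prod.fst).Nodup ∧
      ∀ e ∈ q, e ∈ c := by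
    intro d hd
    -- Rotate the closed walk `l ++ d :: m` to `d :: (m ++ l)`.
    obtain ⟨l, m, rfl⟩ := List.append_of_mem hd
    obtain ⟨x, h₁, h₂⟩ := hw.exists_of_append G
    refine ⟨m ++ l, h₂.2.append G (h₂.1 ▸ h₁), ?_, by simp; tauto⟩
    refine (List.Perm.nodup_iff (List.Perm.map _ ?_)).1 hn
    exact List.perm_append_comm
  rcases mem_or_rev_mem (List.mem_toFinset.1 ha) with h | h
  · obtain ⟨q, h₁, h₂, h₃⟩ := key a h
    exact ⟨q, h₁, h₂, fun d hd => List.mem_toFinset.2 (List.mem_map_of_mem (h₃ d hd))⟩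
  · obtain ⟨q, h₁, h₂, h₃⟩ := key _ h
    have hr : ∀ l : List (E × Bool), (l.map rev).map Prod.fst = l.map Prod.fst := fun l => by
      simp [Function.comp_def]
    refine ⟨(q.map rev).reverse, by simpa using h₁.reverse G, ?_, ?_⟩
    · rw [List.map_cons, List.nodup_cons] at h₂ ⊢
      rw [List.map_reverse, hr, List.nodup_reverse, List.mem_reverse]
      exact h₂
    · intro d hd
      obtain ⟨e, he, rfl⟩ := List.mem_map.1 (List.mem_reverse.1 hd)
      exact List.mem_toFinset.2 (List.mem_map_of_mem (f := Prod.fst) (a := e) (h₃ e he))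

/-- The darts of a simple cycle at the vertices of a subpath are those of the subpath and the two
by which the cycle leaves the subpath. -/
theorem IsPath.dart_of_simpleCycle {γ : Finset E} (hγ : G.IsSimpleCycle γ) {u v : V}
    {p : List (E × Bool)} (hp : G.IsPath u p v) (hpγ : ∀ d ∈ p, d.1 ∈ γ) {a b d : E × Bool}
    (hab : a ≠ b) (hau : G.tail a = u) (hbv : G.tail b = v) (ha : a.1 ∈ γ) (hb : b.1 ∈ γ)
    (hap : a.1 ∉ p.map Prod.fst) (hbp : b.1 ∉ p.map Prod.fst) (hd : d.1 ∈ γ)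
    (hdp : G.tail d ∈ u :: p.map G.head) : d.1 ∈ p.map Prod.fst ∨ d = a ∨ d = b := by
  induction p generalizing u a with
  | nil =>
    cases hp.1
    exact .inr (hγ.eq_or_eq G ha hb hd hab (hbv.trans hau.symm) (by simpa [hau] using hdp))
  | cons e p ih =>
    have he : e.1 ∈ γ := hpγ e (by simp)
    rcases List.mem_cons.1 hdp with h | h
    · have hae : a ≠ e := by rintro rfl; simp at hap
      rcases hγ.eq_or_eq G ha he hd hae (hp.1.1.trans hau.symm) (h.trans hau.symm) with h | rfl
      · exact .inr (.inl h)
      · simp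
    · have hne : rev e ≠ b := by rintro rfl; simp at hbp
      rcases ih (hp.of_cons G) (fun d hd => hpγ d (by simp [hd])) hne rfl he
        (hp.fst_notMem G) (fun h => hbp (List.mem_cons_of_mem _ h)) h with h | rfl | h
      · exact .inl (List.mem_cons_of_mem _ h)
      · simp
      · exact .inr (.inr h)

/-- Each edge contributes one dart at each of its ends, so modulo 2 the interior visits cancel. -/
theorem IsWalk.parity [DecidableEq V] [Fintype E] {u v : V} {p : List (E × Bool)}
    (hp : G.IsWalk u p v) (hn : (p.map Prod.fst).Nodup) (x : V) :
    ((Finset.univ.filter fun d : E × Bool =>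
      d.1 ∈ (p.map Prod.fst).toFinset ∧ G.tail d = x).card : ZMod 2) =
      (if u = x then 1 else 0) + if v = x then 1 else 0 := by
  induction p generalizing u with
  | nil => cases hp; simp [CharTwo.add_self_eq_zero]
  | cons e p ih =>
    obtain ⟨he, hn⟩ := List.nodup_cons.1 hn
    have hsplit : (Finset.univ.filter fun d : E × Bool =>
        d.1 ∈ ((e :: p).map Prod.fst).toFinset ∧ G.tail d = x) =
        (({e, rev e} : Finset (E × Bool)).filter fun d => G.tail d = x) ∪
        (Finset.univ.filter fun d : E × Bool =>
          d.1 ∈ (p.map Prod.fst).toFinset ∧ G.tail d = x) := by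
      ext d
      have : d.1 = e.1 ↔ d = e ∨ d = rev e := ⟨eq_or_eq_rev, by rintro (rfl | rfl) <;> rfl⟩
      simp only [List.map_cons, List.toFinset_cons, Finset.mem_filter, Finset.mem_univ, true_and,
        Finset.mem_insert, Finset.mem_union, Finset.mem_singleton, this]
      tauto
    rw [hsplit, Finset.card_union_of_disjoint, Nat.cast_add, ih hp.2 hn, Finset.filter_insert,
      Finset.filter_singleton, tail_rev, hp.1]
    · have hne := (rev_ne e).symm
      split_ifs <;> simp [hne] <;> decide
    · rw [Finset.disjoint_left]
      intro d h₁ h₂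
      simp only [Finset.mem_filter, Finset.mem_insert, Finset.mem_singleton] at h₁ h₂
      apply he
      rw [← List.mem_toFinset]
      rcases h₁.1 with rfl | rfl
      · exact h₂.2.1
      · exact h₂.2.1

/-- On an orientable surface, two edge-disjoint walks with the same ends have the same
signature. -/
theorem Orientable.sum_sig_eq [DecidableEq V] [Fintype E] (hG : G.Orientable) {u v : V}
    {p q : List (E × Bool)} (hp : G.IsWalk u p v) (hq : G.IsWalk u q v)
    (hpn : (p.map Prod.fst).Nodup) (hqn : (q.map Prod.fst).Nodup)
    (hpq : List.Disjoint (p.map Prod.fst) (q.map Prod.fst)) :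
    (p.map fun d => G.sig d.1).sum = (q.map fun d => G.sig d.1).sum := by
  have hsum : ∀ l : List (E × Bool), (l.map Prod.fst).Nodup →
      ∑ e ∈ (l.map Prod.fst).toFinset, G.sig e = (l.map fun d => G.sig d.1).sum := by
    intro l hl
    rw [List.sum_toFinset _ hl, List.map_map]
    rfl
  have hdis : Disjoint (p.map Prod.fst).toFinset (q.map Prod.fst).toFinset :=
    List.disjoint_toFinset_iff_disjoint.2 hpq
  -- The two walks have the same ends, hence the same degree parities, so their disjoint union is a
  -- cycle.
  have h := hG ((p.map Prod.fst).toFinset ∪ (q.map Prod.fst).toFinset) fun x => by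
    rw [← ZMod.natCast_eq_zero_iff_even]
    have hsplit : (Finset.univ.filter fun d : E × Bool =>
        d.1 ∈ (p.map Prod.fst).toFinset ∪ (q.map Prod.fst).toFinset ∧ G.tail d = x) =
        (Finset.univ.filter fun d : E × Bool =>
          d.1 ∈ (p.map Prod.fst).toFinset ∧ G.tail d = x) ∪
        (Finset.univ.filter fun d : E × Bool =>
          d.1 ∈ (q.map Prod.fst).toFinset ∧ G.tail d = x) := by
      rw [← Finset.filter_or]
      refine Finset.filter_congr fun d _ => ?_
      rw [Finset.mem_union, or_and_right]
    rw [hsplit, Finset.card_union_of_disjoint, Nat.cast_add, hp.parity G hpn, hq.parity G hqn,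
      CharTwo.add_self_eq_zero]
    rw [Finset.disjoint_left]
    intro d h₁ h₂
    exact Finset.disjoint_left.1 hdis (Finset.mem_filter.1 h₁).2.1 (Finset.mem_filter.1 h₂).2.1
  rw [Finset.sum_union hdis, hsum p hpn, hsum q hqn] at h
  exact CharTwo.add_eq_zero.1 h

end Cycles

/-! ### Side indicators of a null-homologous edge set -/

section Sides

variable {V E : Type*} (G : EmbeddedGraph V E)

theorem hop_hop (f : Flag E) : G.hop (G.hop f) = f := by
  simp [hop, add_assoc, CharTwo.add_self_eq_zero]

theorem turn_injective : Function.Injective G.turn := by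
  rintro ⟨d, s⟩ ⟨d', s'⟩ h
  have hs : s = s' := congrArg Prod.snd h
  subst hs
  have hd := congrArg Prod.fst h
  unfold turn at hd
  dsimp only at hd
  split_ifs at hd
  · rw [G.rot.injective hd]
  · rw [G.rot.symm.injective hd]

/-- The inner hop preserves the underlying edge, so two flags treated by different branches cannot
have the same image. -/
theorem contractedTurn_injective [DecidableEq E] (p : List (E × Bool)) :
    Function.Injective (G.contractedTurn p) := by
  intro f f' h
  unfold contractedTurn at h
  have hh : ∀ g : Flag E, (G.hop g).1.1 = g.1.1 := fun _ => rfl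
  split_ifs at h with h₁ h₂ h₂
  · exact (Function.LeftInverse.injective G.hop_hop) (G.turn_injective h)
  · exact absurd ((hh f).symm ▸ h₁) ((G.turn_injective h) ▸ h₂)
  · exact absurd ((hh f').symm ▸ h₂) ((G.turn_injective h) ▸ h₁)
  · exact G.turn_injective h

/-- `χ` is the indicator of a set of faces with boundary `η`, as a function on flags. -/
structure IsSideIndicator (η : Set E) (χ : Flag E → ZMod 2) : Prop where
  turn : ∀ f : Flag E, χ (G.turn f) = χ f + η.indicator 1 f.1.1
  hop : ∀ f : Flag E, χ (G.hop f) = χ f + η.indicator 1 f.1.1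

/-- χ is the membership of the flag's face in the bounding set. The two kinds of `FaceStep` leave it
unchanged, while flipping the local orientation of a flag moves to the other side of its edge. -/
theorem NullHomologous.exists_isSideIndicator {B : Set G.Face} {η : Finset E}
    (h : G.NullHomologous B η) : ∃ χ, G.IsSideIndicator (η : Set E) χ := by
  classical
  obtain ⟨F, -, hF⟩ := h
  let χ : Flag E → ZMod 2 := fun f => if G.face f ∈ F then 1 else 0
  have h₁ : ∀ f : Flag E, χ (G.turn (G.hop f)) = χ f := fun f => by
    simp only [χ, face, ← Quot.sound (show G.FaceStep f (G.turn (G.hop f)) from .inl rfl)]; rfl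
  have h₂ : ∀ f : Flag E, χ ((G.hop f).1, (G.hop f).2 + 1) = χ f := fun f => by
    simp only [χ, face,
      ← Quot.sound (show G.FaceStep f ((G.hop f).1, (G.hop f).2 + 1) from .inr rfl)]; rfl
  have two : ∀ s : ZMod 2, s = 0 ∨ s = 1 := by decide
  have h₃ : ∀ e, χ ((e, false), 0) + χ ((e, false), 1) = (η : Set E).indicator 1 e := by
    intro e
    have := hF e
    simp only [InBoundary, Xor] at this
    simp only [χ, Set.indicator, Finset.mem_coe, Pi.one_apply, this]
    split_ifs <;> first | rfl | tauto
  have h₄ : ∀ (e : E) (s : ZMod 2),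
      χ ((e, false), s + 1) = χ ((e, false), s) + (η : Set E).indicator 1 e := by
    intro e s
    rw [← h₃]
    rcases two s with rfl | rfl
    · rw [← add_assoc, CharTwo.add_self_eq_zero, zero_add, zero_add]
    · rw [add_comm (χ ((e, false), 0)), ← add_assoc, CharTwo.add_self_eq_zero,
        CharTwo.add_self_eq_zero, zero_add]
  have h₅ : ∀ (d : E × Bool) (s : ZMod 2),
      χ (d, s + 1) = χ (d, s) + (η : Set E).indicator 1 d.1 := by
    rintro ⟨e, b⟩ s
    cases b with
    | false => exact h₄ e s
    | true =>
      have h := h₂ ((e, true), s)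
      have h' := h₂ ((e, true), s + 1)
      simp only [EmbeddedGraph.hop, rev, Bool.not_true] at h h'
      rw [← h, ← h', ← h₄]
      congr 2
      ring
  -- Reversing the walk on the same side is a hop followed by a flip, so a bare hop names the
  -- opposite side.
  have hhop : ∀ f : Flag E, χ (G.hop f) = χ f + (η : Set E).indicator 1 f.1.1 := fun f => by
    have := h₅ (G.hop f).1 (G.hop f).2
    rw [h₂] at this
    rw [this, add_assoc]
    change χ (G.hop f) = _ + ((η : Set E).indicator 1 f.1.1 + _)
    rw [CharTwo.add_self_eq_zero, add_zero]
  refine ⟨χ, fun f => ?_, hhop⟩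
  have := h₁ (G.hop f)
  rw [hop_hop] at this
  rw [this, hhop]

variable {G}

/-- The edges followed inside p are not in η, so neither the hop nor the turn there changes χ. -/
theorem IsSideIndicator.contractedTurn [DecidableEq E] {η : Set E} {χ : Flag E → ZMod 2}
    (hχ : G.IsSideIndicator η χ) {p : List (E × Bool)} (hp : ∀ d ∈ p, d.1 ∉ η) (f : Flag E) :
    χ (G.contractedTurn p f) = χ f + η.indicator 1 f.1.1 := by
  unfold EmbeddedGraph.contractedTurn
  split_ifs with h
  · obtain ⟨d, hd, hdf⟩ := List.mem_map.1 h
    have : f.1.1 ∉ η := hdf ▸ hp d hd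
    rw [hχ.turn, hχ.hop, add_assoc]
    change _ + (η.indicator 1 f.1.1 + η.indicator 1 f.1.1) = _
    simp [this]
  · exact hχ.turn f

theorem iterate_eq_add_one {η : Set E} {χ : Flag E → ZMod 2} {ρ : Flag E → Flag E}
    (h : ∀ f, χ (ρ f) = χ f + η.indicator 1 f.1.1) {f : Flag E} {n : ℕ} (hn : 0 < n)
    (h₀ : f.1.1 ∈ η) (hm : ∀ m, 0 < m → m < n → (ρ^[m] f).1.1 ∉ η) : χ (ρ^[n] f) = χ f + 1 := by
  induction n, hn using Nat.le_induction with
  | base => simp [h, h₀]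
  | succ n hn ih =>
    rw [Function.iterate_succ_apply', h, ih fun m h₁ h₂ => hm m h₁ (by omega)]
    simp [hm n hn (by omega)]

/-- The sides of `η` change when turning from one edge of `η` to the only other one at the same
vertex. -/
theorem IsSideIndicator.eq_add_one [Finite E] {η : Set E} {χ : Flag E → ZMod 2}
    (hχ : G.IsSideIndicator η χ) {a b : E × Bool} (hab : a ≠ b) (ht : G.tail a = G.tail b)
    (ha : a.1 ∈ η) (hη : ∀ d : E × Bool, G.tail d = G.tail a → d.1 ∈ η → d = a ∨ d = b)
    (s : ZMod 2) : χ (b, s) = χ (a, s) + 1 := by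
  classical
  have hσ : ∃ σ : Equiv.Perm (E × Bool), (∀ d, G.turn (d, s) = (σ d, s)) ∧ σ.SameCycle a b := by
    by_cases hs : s = 0
    · exact ⟨G.rot, fun d => by simp [EmbeddedGraph.turn, hs], G.rot_sameCycle a b ht⟩
    · exact ⟨G.rot⁻¹, fun d => by simp [EmbeddedGraph.turn, hs],
        Equiv.Perm.sameCycle_inv.2 (G.rot_sameCycle a b ht)⟩
  obtain ⟨σ, hσ, hc⟩ := hσ
  have hit : ∀ n : ℕ, G.turn^[n] (a, s) = ((σ ^ n) a, s) := fun n => by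
    induction n with
    | zero => rfl
    | succ n ih => rw [Function.iterate_succ_apply', ih, hσ, pow_succ']; rfl
  have hex : ∃ n : ℕ, (σ ^ n) a = b := by
    obtain ⟨n, -, h⟩ := hc.exists_pow_eq'
    exact ⟨n, h⟩
  have htail : ∀ n : ℕ, G.tail ((σ ^ n) a) = G.tail a := fun n => by
    induction n with
    | zero => rfl
    | succ n ih =>
      have := G.tail_turn ((σ ^ n) a, s)
      rw [hσ] at this
      rw [pow_succ', Equiv.Perm.mul_apply, this, ih]
  have hpos : 0 < Nat.find hex := by
    rw [Nat.find_pos]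
    exact hab
  -- Before the first arrival at b no η-dart is met: a return to a would, by periodicity, give an
  -- earlier arrival.
  have h := iterate_eq_add_one (f := (a, s)) hχ.turn hpos ha fun m h₁ h₂ hm => by
    rw [hit] at hm
    rcases hη _ (htail m) hm with h | h
    · have hlt : Nat.find hex - m < Nat.find hex := by omega
      apply Nat.find_min hex hlt
      calc (σ ^ (Nat.find hex - m)) a = (σ ^ (Nat.find hex - m)) ((σ ^ m) a) :=
            congrArg _ h.symm
        _ = b := by
          rw [← Equiv.Perm.mul_apply, ← pow_add, Nat.sub_add_cancel h₂.le]
          exact Nat.find_spec hex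
    · exact Nat.find_min hex h₂ h
  rwa [hit, Nat.find_spec hex] at h

end Sides

/-! ### Common vertices, the excursion outside p, and the turn around p -/

section Crossing

variable {V E : Type*} [DecidableEq E] {G : EmbeddedGraph V E}

/-- The common vertices of two isometric cycles lie on any maximal common subpath. -/
theorem IsIsometricCycle.mem_of_onCycle {w : E → ℝ} (hw : G.UniqueShortestPaths w)
    {γ γ' : Finset E} (hγ : G.IsIsometricCycle w γ) (hγ' : G.IsIsometricCycle w γ') {u x : V}
    {p : List (E × Bool)}
    (hp : ∀ d : E × Bool, d.1 ∈ γ → d.1 ∈ γ' → G.tail d ∈ u :: p.map G.head →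
      G.head d ∈ u :: p.map G.head)
    (hu : G.OnCycle γ u) (hu' : G.OnCycle γ' u) (hx : G.OnCycle γ x) (hx' : G.OnCycle γ' x) :
    x ∈ u :: p.map G.head := by
  obtain ⟨q, hq, hqγ⟩ := hγ.2 u x hu hx
  obtain ⟨q', hq', hqγ'⟩ := hγ'.2 u x hu' hx'
  obtain rfl := hw u x q q' hq hq'
  -- The common shortest path consists of common edges, and by `hp` such an edge starting on p also
  -- ends on p.
  have key : ∀ (r : List (E × Bool)) (y : V), y ∈ u :: p.map G.head → G.IsWalk y r x →
      (∀ d ∈ r, d.1 ∈ γ) → (∀ d ∈ r, d.1 ∈ γ') → x ∈ u :: p.map G.head := by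
    intro r
    induction r with
    | nil => rintro y hy h - -; exact (show y = x from h) ▸ hy
    | cons d r ih =>
      intro y hy h h₁ h₂
      refine ih _ (hp d (h₁ d (by simp)) (h₂ d (by simp)) (h.1 ▸ hy)) h.2
        (fun e he => h₁ e (by simp [he])) (fun e he => h₂ e (by simp [he]))
  exact key q u (by simp) hq.1.1 hqγ hqγ'

/-- Following `γ` from a vertex set `S` back to `S`: the excursion has the same set of faces on
the same side all along. -/
theorem IsSideIndicator.exists_excursion [Finite E] {γ γ' : Finset E}
    {χ : Flag E → ZMod 2} (hχ : G.IsSideIndicator (symmDiff γ γ' : Finset E) χ)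
    (hγ : G.IsSimpleCycle γ) {S : Set V} {a₁ a₂ : E × Bool} {P : Set E}
    (hS : ∀ x, G.OnCycle γ x → G.OnCycle γ' x → x ∈ S)
    (hP : ∀ d : E × Bool, d.1 ∈ P → G.tail d ∈ S)
    (hdart : ∀ d : E × Bool, d.1 ∈ γ → G.tail d ∈ S → d.1 ∈ P ∨ d = a₁ ∨ d = a₂)
    (hcom : ∀ d : E × Bool, d.1 ∈ γ → d.1 ∈ γ' → d.1 ∈ P)
    (q : List (E × Bool)) (d : E × Bool) {z : V} (hz : z ∈ S) (hq : G.IsWalk (G.head d) q z)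
    (hn : ((d :: q).map Prod.fst).Nodup) (hqγ : ∀ e ∈ d :: q, e.1 ∈ γ) (hdP : d.1 ∉ P)
    (ha : rev a₁ ∉ d :: q) :
    ∃ r, r.Sublist (d :: q) ∧ G.IsWalk (G.tail d) r (G.tail a₂) ∧ (∀ e ∈ r, e.1 ∉ P) ∧
      ∀ s, χ (a₂, s + (r.map fun e => G.sig e.1).sum) = χ (d, s) + 1 := by
  induction q generalizing d with
  | nil =>
    cases hq
    have hdγ : d.1 ∈ γ := hqγ d (by simp)
    have hdη : d.1 ∈ ((symmDiff γ γ' : Finset E) : Set E) := by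
      rw [Finset.mem_coe, Finset.mem_symmDiff]
      exact .inl ⟨hdγ, fun h => hdP (hcom d hdγ h)⟩
    rcases hdart (rev d) hdγ hz with h | h | h
    · exact absurd h hdP
    · exact absurd (by simp [← h]) ha
    · subst h
      refine ⟨[d], List.Sublist.refl _, ⟨rfl, rfl⟩, by simpa using hdP, fun s => ?_⟩
      have := hχ.hop (d, s)
      rw [Set.indicator_of_mem hdη] at this
      simpa [EmbeddedGraph.hop] using this
  | cons d' q ih =>
    have hdγ : d.1 ∈ γ := hqγ d (by simp)
    have hdγ' : d.1 ∉ γ' := fun h => hdP (hcom d hdγ h)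
    have hdη : d.1 ∈ ((symmDiff γ γ' : Finset E) : Set E) := by
      rw [Finset.mem_coe, Finset.mem_symmDiff]
      exact .inl ⟨hdγ, hdγ'⟩
    -- The excursion stops at its first return to S. It must arrive through a₁ or a₂, and a₁ is
    -- excluded by `ha`.
    by_cases hx : G.head d ∈ S
    · rcases hdart (rev d) hdγ hx with h | h | h
      · exact absurd h hdP
      · exact absurd (by simp [← h]) ha
      · subst h
        refine ⟨[d], by simp, ⟨rfl, rfl⟩, by simpa using hdP, fun s => ?_⟩
        have := hχ.hop (d, s)
        rw [Set.indicator_of_mem hdη] at this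
        simpa [EmbeddedGraph.hop] using this
    · have hd'γ : d'.1 ∈ γ := hqγ d' (by simp)
      have hd'P : d'.1 ∉ P := fun h => hx (hq.1 ▸ hP d' h)
      obtain ⟨hdn, hn'⟩ := List.nodup_cons.1 hn
      have hne : rev d ≠ d' := by rintro rfl; simp at hdn
      obtain ⟨r, h₁, h₂, h₃, h₄⟩ := ih d' hq.2 hn' (fun e he => hqγ e (List.mem_cons_of_mem _ he))
        hd'P (fun h => ha (List.mem_cons_of_mem _ h))
      refine ⟨d :: r, h₁.cons_cons d, ⟨rfl, hq.1 ▸ h₂⟩, ?_, fun s => ?_⟩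
      · intro e he
        rcases List.mem_cons.1 he with rfl | he
        · exact hdP
        · exact h₃ e he
      -- Outside S the vertex is not on γ', so the only η-darts there are the two of γ.
      · have hturn := hχ.eq_add_one hne hq.1.symm hdη (fun e he heη => by
          have heγ : e.1 ∈ γ := by
            by_contra hc
            rw [Finset.mem_coe, Finset.mem_symmDiff] at heη
            have heγ' : e.1 ∈ γ' := by tauto
            exact hx (hS _ ⟨rev d, hdγ, rfl⟩ ⟨e, heγ', he⟩)
          exact hγ.eq_or_eq G (a := rev d) hdγ hd'γ heγ hne hq.1 he) (s + G.sig d.1)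
        have hhop := hχ.hop (d, s)
        rw [Set.indicator_of_mem hdη] at hhop
        change χ (rev d, s + G.sig d.1) = χ (d, s) + 1 at hhop
        rw [List.map_cons, List.sum_cons, ← add_assoc, h₄, hturn, hhop, add_assoc (χ (d, s)),
          CharTwo.add_self_eq_zero, add_zero]

/-- When turning around a contracted path, the two ends of `γ` and the two ends of `γ'` being
met alternately, the sides of `symmDiff γ γ'` change twice between the ends of `γ`. -/
theorem IsSideIndicator.eq_of_inCyclicOrder {η : Set E} {χ : Flag E → ZMod 2}
    (hχ : G.IsSideIndicator η χ) {u v : V} {p : List (E × Bool)} (hp : G.IsPath u p v)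
    (hpη : ∀ d ∈ p, d.1 ∉ η) {a₁ a₂ b₁ b₂ : E × Bool} {s₁ s₂ t₁ t₂ : ZMod 2}
    (ha : a₁.1 ∈ η) (hb : b₁.1 ∈ η) (ha₁ : G.tail a₁ = u) (ha₂ : G.tail a₂ = v)
    (hη : ∀ d : E × Bool, d.1 ∈ η → G.tail d ∈ u :: p.map G.head →
      d = a₁ ∨ d = a₂ ∨ d = b₁ ∨ d = b₂)
    (h : InCyclicOrder (G.contractedTurn p) (a₁, s₁) (b₁, t₁) (a₂, s₂) (b₂, t₂)) :
    χ (a₂, s₂) = χ (a₁, s₁) ∧ s₂ = s₁ + (p.map fun d => G.sig d.1).sum := by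
  obtain ⟨i, j, k, hi, hij, hjk, hbi, haj, hbk, hret⟩ := h
  set ρ := G.contractedTurn p with hρ
  have hinj : ∀ m n : ℕ, m < n → n ≤ k → ρ^[m] (a₁, s₁) ≠ ρ^[n] (a₁, s₁) := by
    intro m n hmn hnk he
    refine hret (n - m) (by omega) (by omega) ?_
    apply (G.contractedTurn_injective p).iterate m
    rw [← hρ, ← Function.iterate_add_apply, Nat.add_sub_cancel' hmn.le, ← he]
  obtain ⟨o, ho₁, ho₂, ho⟩ := hp.exists_orientation G s₁
  -- The local orientation met at a vertex of p is always the one propagated along p, so a visited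
  -- flag is determined by its dart.
  have hinv : ∀ m, G.tail (ρ^[m] (a₁, s₁)).1 ∈ u :: p.map G.head ∧
      (ρ^[m] (a₁, s₁)).2 = o (G.tail (ρ^[m] (a₁, s₁)).1) := by
    intro m
    induction m with
    | zero => simp [ha₁, ho₁]
    | succ m ih =>
      rw [Function.iterate_succ_apply']
      generalize ρ^[m] (a₁, s₁) = f at ih
      rw [hρ, EmbeddedGraph.contractedTurn]
      split_ifs with hf
      · rw [tail_turn]
        refine ⟨hp.1.tail_mem G (d := rev f.1) hf, ?_⟩
        change f.2 + G.sig f.1.1 = o (G.head f.1)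
        rw [ho f.1 hf, ih.2]
      · rw [tail_turn]
        exact ih
  have heq : ∀ m n, (ρ^[m] (a₁, s₁)).1 = (ρ^[n] (a₁, s₁)).1 →
      ρ^[m] (a₁, s₁) = ρ^[n] (a₁, s₁) := fun m n hmn =>
    Prod.ext hmn (by rw [(hinv m).2, (hinv n).2, hmn])
  have hnot : ∀ m, m < j → m ≠ 0 → m ≠ i → (ρ^[m] (a₁, s₁)).1.1 ∉ η := by
    intro m hmj hm₀ hmi hm
    have ne : ∀ n, n ≤ k → n ≠ m → (ρ^[m] (a₁, s₁)).1 ≠ (ρ^[n] (a₁, s₁)).1 := by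
      intro n hn hnm he
      rcases lt_or_gt_of_ne hnm with hlt | hlt
      · exact hinj n m hlt (by omega) (heq m n he).symm
      · exact hinj m n hlt hn (heq m n he)
    rcases hη _ hm (hinv m).1 with h | h | h | h
    · exact ne 0 (by omega) (by omega) h
    · exact ne j (by omega) (by omega) (by rw [haj, h])
    · exact ne i (by omega) (by omega) (by rw [hbi, h])
    -- Alternation enters here: b₂ comes only after a₂, so it cannot be met between a₁ and a₂.
    · exact ne k (by omega) (by omega) (by rw [hbk, h])
  have hstep := hχ.contractedTurn hpη
  have h₁ := iterate_eq_add_one hstep (f := (a₁, s₁)) hi ha fun m h₁ h₂ =>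
    hnot m (by omega) (by omega) (by omega)
  have hsub : ρ^[j - i] (b₁, t₁) = (a₂, s₂) := by
    rw [← hbi, ← Function.iterate_add_apply, Nat.sub_add_cancel hij.le, haj]
  have h₂ := iterate_eq_add_one hstep (f := (b₁, t₁)) (n := j - i) (by omega) hb
    fun m h₁ h₂ => by
      rw [← hbi, ← hρ, ← Function.iterate_add_apply]
      exact hnot _ (by omega) (by omega) (by omega)
  rw [← hρ] at h₁ h₂
  rw [hbi] at h₁
  rw [hsub, h₁, add_assoc, CharTwo.add_self_eq_zero, add_zero] at h₂
  refine ⟨h₂, ?_⟩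
  have := (hinv j).2
  rw [haj] at this
  rw [← ho₂, ← ha₂]
  exact this

end Crossing

end EmbeddedGraph

/-! ### The contradiction at a crossing -/

theorem mainTheorem5 {V E : Type*} [DecidableEq V] [Fintype E] [DecidableEq E]
    (G : EmbeddedGraph V E) (hG : G.Orientable) (B : Set G.Face)
    (w : E → ℝ) (hw : G.UniqueShortestPaths w)
    (γ γ' : Finset E) (hγ : G.IsIsometricCycle w γ) (hγ' : G.IsIsometricCycle w γ')
    (h : G.Homologous B γ γ') : ¬ G.Cross γ γ' := by
  rintro ⟨u, v, p, a₁, a₂, b₁, b₂, s₁, s₂, t₁, t₂, hp, hpγ, hane, hbne, ha₁u, hb₁u, ha₂v, hb₂v,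
    ha₁, ha₂, hb₁, hb₂, hcyc⟩
  rw [Finset.mem_sdiff] at ha₁ ha₂ hb₁ hb₂
  obtain ⟨χ, hχ⟩ := EmbeddedGraph.NullHomologous.exists_isSideIndicator G h
  have hpE : ∀ e ∈ p.map Prod.fst, e ∈ γ ∧ e ∈ γ' := fun e he => by
    obtain ⟨d, hd, rfl⟩ := List.mem_map.1 he
    exact hpγ d hd
  have hdart : ∀ d : E × Bool, d.1 ∈ γ → G.tail d ∈ u :: p.map G.head →
      d.1 ∈ p.map Prod.fst ∨ d = a₁ ∨ d = a₂ := fun d hd hdp =>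
    hp.dart_of_simpleCycle G hγ.1 (fun d hd => (hpγ d hd).1) hane ha₁u ha₂v ha₁.1 ha₂.1
      (fun h => ha₁.2 (hpE _ h).2) (fun h => ha₂.2 (hpE _ h).2) hd hdp
  have hdart' : ∀ d : E × Bool, d.1 ∈ γ' → G.tail d ∈ u :: p.map G.head →
      d.1 ∈ p.map Prod.fst ∨ d = b₁ ∨ d = b₂ := fun d hd hdp =>
    hp.dart_of_simpleCycle G hγ'.1 (fun d hd => (hpγ d hd).2) hbne hb₁u hb₂v hb₁.1 hb₂.1
      (fun h => hb₁.2 (hpE _ h).1) (fun h => hb₂.2 (hpE _ h).1) hd hdp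
  have hclosed : ∀ d : E × Bool, d.1 ∈ γ → d.1 ∈ γ' → G.tail d ∈ u :: p.map G.head →
      d.1 ∈ p.map Prod.fst := by
    intro d h₁ h₂ h₃
    rcases hdart d h₁ h₃ with h | rfl | rfl
    · exact h
    · exact absurd h₂ ha₁.2
    · exact absurd h₂ ha₂.2
  have hcommon : ∀ x, G.OnCycle γ x → G.OnCycle γ' x → x ∈ u :: p.map G.head := fun x =>
    hγ.mem_of_onCycle hw hγ'
      (fun d h₁ h₂ h₃ => hp.1.tail_mem G (d := EmbeddedGraph.rev d) (hclosed d h₁ h₂ h₃))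
      ⟨a₁, ha₁.1, ha₁u⟩ ⟨b₁, hb₁.1, hb₁u⟩
  have hmem : ∀ e, e ∈ ((symmDiff γ γ' : Finset E) : Set E) ↔
      e ∈ γ ∧ e ∉ γ' ∨ e ∈ γ' ∧ e ∉ γ := fun e => by
    rw [Finset.mem_coe, Finset.mem_symmDiff]
  obtain ⟨hχ₁, hs₂⟩ := hχ.eq_of_inCyclicOrder hp
    (fun d hd hη => by have := hpγ d hd; rw [hmem] at hη; tauto)
    ((hmem _).2 (.inl ha₁)) ((hmem _).2 (.inr hb₁)) ha₁u ha₂v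
    (fun d hd hdp => by
      rcases (hmem _).1 hd with h | h
      · rcases hdart d h.1 hdp with h' | h' | h'
        · exact absurd (hpE _ h').2 h.2
        · exact .inl h'
        · exact .inr (.inl h')
      · rcases hdart' d h.1 hdp with h' | h'
        · exact absurd (hpE _ h').1 h.2
        · exact .inr (.inr h')) hcyc
  obtain ⟨q, hq, hqn, hqγ⟩ := hγ.1.exists_walk G ha₁.1
  have ha₁q : EmbeddedGraph.rev a₁ ∉ a₁ :: q := by
    intro hr
    rcases List.mem_cons.1 hr with hr | hr
    · exact EmbeddedGraph.rev_ne _ hr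
    · exact (List.nodup_cons.1 hqn).1 (List.mem_map_of_mem (f := Prod.fst) (a := EmbeddedGraph.rev a₁) hr)
  obtain ⟨r, hrq, hr, hrp, hχ₂⟩ := hχ.exists_excursion hγ.1
    (S := {x | x ∈ u :: p.map G.head}) (a₁ := a₁) (a₂ := a₂) (P := {e | e ∈ p.map Prod.fst})
    hcommon (fun d hd => hp.1.tail_mem G hd) hdart
    (fun d h₁ h₂ => hclosed d h₁ h₂ (hcommon _ ⟨d, h₁, rfl⟩ ⟨d, h₂, rfl⟩)) q a₁
    (z := G.tail a₁) (by simp [ha₁u]) hq hqn (by simpa [ha₁.1] using hqγ)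
    (fun h => ha₁.2 (hpE _ h).2) ha₁q
  -- The excursion r and the path p are edge-disjoint walks from u to v, so both ways of reaching a₂
  -- give the same local orientation.
  have hsum := hG.sum_sig_eq G hp.1 (ha₁u ▸ ha₂v ▸ hr) (hp.nodup_fst G)
    (hqn.sublist (hrq.map _)) (fun e he he' => by
      obtain ⟨d, hd, rfl⟩ := List.mem_map.1 he'
      exact hrp d hd he)
  have := hχ₂ s₁
  rw [← hsum, ← hs₂, hχ₁] at this
  simp at this
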